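/- Let $H_{12}$ be the Lie group of unimodular lower triangular real $3\times 3$ matrices $\left[\begin{smallmatrix}1&0&0\\ y_1&1&0\\ y_3&y_2&1\end{smallmatrix}\right]$, with left-invariant frame $X_1=\partial_{y_1}+y_2\partial_{y_3}$, $X_2=\partial_{y_2}$, $X_3=\partial_{y_3}$ and dual coframe $\theta_1=dy_1$, $\theta_2=dy_2$, $\theta_3=-y_2dy_1+dy_3$, so that its Maurer–Cartan form is $\omega_{H_{12}}=\sum_i\theta_iX_i$ with values in its Lie algebra $\mathfrak k=\langle X_1,X_2,X_3\rangle$. Let $P_1\subset PGL(4,\mathbb R)$ be the parabolic subgroup of classes of $(1,3)$-block upper triangular matrices, with Lie algebra $\mathfrak p_1\subset\mathfrak g=\mathfrak{sl}(4,\mathbb R)$ and nilradical $\mathfrak p_+$, and let $\tau:H_{12}\to H_{12}\times P_1$, $\tau(k)=(k,e)$. An extension of $(H_{12},\{\mathrm{id}\})$ to $(PGL(4,\mathbb R),P_1)$ is a linear map $\alpha:\mathfrak k\to\mathfrak g$ (together with the trivial homomorphism $\{\mathrm{id}\}\to P_1$) which induces a linear isomorphism $\mathfrak k\cong\mathfrak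 g/\mathfrak p_1$; its curvature is $\kappa(\alpha(X)+\mathfrak p_1,\alpha(Y)+\mathfrak p_1)=[\alpha(X),\alpha(Y)]-\alpha([X,Y])$. An element $\kappa\in\wedge^2(\mathfrak g/\mathfrak p_1)^*\otimes\mathfrak g$ is called normal if $2\sum_i[Z_i,\kappa(X,B_i)]-\sum_i\kappa([Z_i,X],B_i)=0$ for all $X\in\mathfrak g$, where the $B_i\in\mathfrak g$ represent a basis of $\mathfrak g/\mathfrak p_1$ and the $Z_i\in\mathfrak p_+$ form the dual basis with respect to the Killing form. An extension is normal if its curvature is normal, and a Cartan connection is normal if all the values of its curvature function are normal. Let $\omega$ be a smooth Cartan connection of type $(PGL(4,\mathbb R),P_1)$ on the trivial principal bundle $H_{12}\times P_1$ such that $$\tau^*\omega=\begin{bmatrix} \sum_k a^k\theta_k & \sum_k \mathrm P^k_j\theta_k\\ \theta_i & \sum_k A^{jk}_i\theta_k\end{bmatrix}$$ for functions $a^k,A^{jk}_i,\mathrm P^k_j$ on $H_{12}$ (with $i$ the row index and $j$ the column index). Then: 1. $\omega$ is invariant under the left action of $H_{12}$ on $H_{12}\times P_1$ if and only if all the functions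 $a^k,A^{jk}_i,\mathrm P^k_j$ are constant. 2. If they are constant, then $$\alpha(x_1X_1+x_2X_2+x_3X_3):=\begin{bmatrix} \sum_k a^kx_k & \sum_k \mathrm P^k_jx_k\\ x_i & \sum_k A^{jk}_ix_k\end{bmatrix}$$ defines an extension of $(H_{12},\{\mathrm{id}\})$ to $(PGL(4,\mathbb R),P_1)$ such that $\tau^*\omega=\alpha\circ\omega_{H_{12}}$, that is, $\omega$ is the Cartan connection given by this extension. If moreover $\omega$ is normal (as it is for the Cartan connection of a projective structure), then this extension is normal. -/

import Mathlib

open scoped Matrix MatrixGroups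

attribute [local instance] LieRing.ofAssociativeRing

noncomputable section

namespace HeisProj

/-! ### The Heisenberg group `H₁₂` and its Lie algebra -/

/-- The general linear group element `exp M`. -/
def expGL {n : Type*} [Fintype n] [DecidableEq n] (M : Matrix n n ℝ) : GL n ℝ :=
  (Matrix.isUnit_exp M).unit

/-- The usual parametrization of unimodular lower triangular `3 × 3` matrices by
`(y₁, y₂, y₃) = (y 0, y 1, y 2)`. -/
def heisMat (y : Fin 3 → ℝ) : Matrix (Fin 3) (Fin 3) ℝ :=
  !![1, 0, 0; y 0, 1, 0; y 2, y 1, 1]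

lemma heisMat_mul (y z : Fin 3 → ℝ) :
    heisMat y * heisMat z =
      heisMat ![y 0 + z 0, y 1 + z 1, y 2 + z 2 + y 1 * z 0] := by
  ext i j
  fin_cases i <;> fin_cases j <;>
    simp [heisMat, Matrix.mul_apply, Fin.sum_univ_three] <;> ring

lemma heisMat_zero : heisMat 0 = 1 := by
  ext i j
  fin_cases i <;> fin_cases j <;> simp [heisMat]

/-- The point of `GL(3, ℝ)` with coordinates `y`. -/
def heisGL (y : Fin 3 → ℝ) : GL (Fin 3) ℝ where
  val := heisMat y
  inv := heisMat ![-y 0, -y 1, -y 2 + y 1 * y 0]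
  val_inv := by
    rw [heisMat_mul, ← heisMat_zero]; congr 1; ext i; fin_cases i <;> simp
  inv_val := by
    rw [heisMat_mul, ← heisMat_zero]; congr 1; ext i; fin_cases i <;> simp

/-- Coordinates `(y₁, y₂, y₃)` of a matrix. -/
def heisCoord (M : Matrix (Fin 3) (Fin 3) ℝ) : Fin 3 → ℝ := ![M 1 0, M 2 1, M 2 0]

lemma heisCoord_heisMat (y : Fin 3 → ℝ) : heisCoord (heisMat y) = y := by
  ext i; fin_cases i <;> simp [heisCoord, heisMat]

/-- Lower triangular with ones on the diagonal. -/
def IsLowerUnitriangular (M : Matrix (Fin 3) (Fin 3) ℝ) : Prop :=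
  (∀ i, M i i = 1) ∧ ∀ i j, i < j → M i j = 0

lemma isLowerUnitriangular_heisMat (y : Fin 3 → ℝ) : IsLowerUnitriangular (heisMat y) := by
  constructor
  · intro i; fin_cases i <;> simp [heisMat]
  · intro i j h; fin_cases i <;> fin_cases j <;> simp [heisMat] at h ⊢

lemma IsLowerUnitriangular.eq_heisMat {M : Matrix (Fin 3) (Fin 3) ℝ}
    (h : IsLowerUnitriangular M) : M = heisMat (heisCoord M) := by
  ext i j
  fin_cases i <;> fin_cases j <;> simp [heisMat, heisCoord, h.1] <;> exact h.2 _ _ (by decide)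

/-- The Lie group `H₁₂` of unimodular lower triangular real `3 × 3` matrices. -/
def H12 : Subgroup (GL (Fin 3) ℝ) where
  carrier := {g | IsLowerUnitriangular (g : Matrix (Fin 3) (Fin 3) ℝ)}
  one_mem' := by
    have := isLowerUnitriangular_heisMat 0
    rwa [heisMat_zero] at this
  mul_mem' := by
    intro g g' hg hg'
    have h := hg.eq_heisMat
    have h' := hg'.eq_heisMat
    simp only [Set.mem_ofPred_eq, Units.val_mul]
    rw [h, h', heisMat_mul]
    exact isLowerUnitriangular_heisMat _
  inv_mem' := by
    intro g hg
    have h : g = heisGL (heisCoord (g : Matrix (Fin 3) (Fin 3) ℝ)) := Units.ext hg.eq_heisMat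
    rw [h]
    exact isLowerUnitriangular_heisMat _

/-- The global coordinates `(y₁, y₂, y₃)` on `H₁₂`. -/
def coordH (k : H12) : Fin 3 → ℝ := heisCoord ((k : GL (Fin 3) ℝ) : Matrix (Fin 3) (Fin 3) ℝ)

/-- The point of `H₁₂` with coordinates `y`. -/
def pointH (y : Fin 3 → ℝ) : H12 := ⟨heisGL y, isLowerUnitriangular_heisMat y⟩

lemma coordH_pointH (y : Fin 3 → ℝ) : coordH (pointH y) = y := heisCoord_heisMat y

lemma pointH_coordH (k : H12) : pointH (coordH k) = k :=
  Subtype.ext (Units.ext (IsLowerUnitriangular.eq_heisMat k.2).symm)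

/-- The matrix `x₁X₁ + x₂X₂ + x₃X₃`, where `X₁, X₂, X₃` are the values at the identity of the
left-invariant vector fields `∂₁ + y₂∂₃`, `∂₂`, `∂₃`. -/
def lowerMat (x : Fin 3 → ℝ) : Matrix (Fin 3) (Fin 3) ℝ :=
  !![0, 0, 0; x 0, 0, 0; x 2, x 1, 0]

/-- The Lie algebra `𝔨` of `H₁₂`: strictly lower triangular matrices with the commutator. -/
def heisAlg : LieSubalgebra ℝ (Matrix (Fin 3) (Fin 3) ℝ) where
  carrier := {M | ∀ i j, i ≤ j → M i j = 0}
  add_mem' := by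
    intro M N hM hN i j h
    simp [hM i j h, hN i j h]
  zero_mem' := by intro i j _; rfl
  smul_mem' := by
    intro c M hM i j h
    simp [hM i j h]
  lie_mem' := by
    intro M N hM hN i j h
    have aux : ∀ {A B : Matrix (Fin 3) (Fin 3) ℝ}, (∀ i j, i ≤ j → A i j = 0) →
        (∀ i j, i ≤ j → B i j = 0) → (A * B) i j = 0 := by
      intro A B hA hB
      rw [Matrix.mul_apply]
      refine Finset.sum_eq_zero fun l _ => ?_
      rcases le_total i l with hl | hl
      · rw [hA i l hl, zero_mul]
      · rw [hB l j (hl.trans h), mul_zero]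
    rw [Ring.lie_def, Matrix.sub_apply, aux hM hN, aux hN hM, sub_zero]

/-- The element `x₁X₁ + x₂X₂ + x₃X₃` of `𝔨`. -/
def heisVec (x : Fin 3 → ℝ) : heisAlg :=
  ⟨lowerMat x, by
    intro i j h; fin_cases i <;> fin_cases j <;> simp [lowerMat] at h ⊢⟩

/-- The Maurer–Cartan coframe `θ₁ = dy₁`, `θ₂ = dy₂`, `θ₃ = -y₂ dy₁ + dy₃` at `k`, evaluated on
the tangent vector `∑ vᵢ ∂ᵢ`. -/
def theta (k : H12) (v : Fin 3 → ℝ) : Fin 3 → ℝ :=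
  ![v 0, v 1, -coordH k 1 * v 0 + v 2]

/-- The Maurer–Cartan form `ω_K = ∑ θᵢ Xᵢ` of `H₁₂`. -/
def maurerCartan (k : H12) (v : Fin 3 → ℝ) : heisAlg := heisVec (theta k v)

/-- `maurerCartan` is `k⁻¹ dk`: the differential of `y ↦ heisMat y` in direction `v` is
`lowerMat v`. -/
lemma mul_maurerCartan (k : H12) (v : Fin 3 → ℝ) :
    ((k : GL (Fin 3) ℝ) : Matrix (Fin 3) (Fin 3) ℝ) *
      (maurerCartan k v : Matrix (Fin 3) (Fin 3) ℝ) = lowerMat v := by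
  have h : ((k : GL (Fin 3) ℝ) : Matrix (Fin 3) (Fin 3) ℝ) = heisMat (coordH k) :=
    IsLowerUnitriangular.eq_heisMat k.2
  rw [h]
  ext i j
  fin_cases i <;> fin_cases j <;>
    simp [heisMat, maurerCartan, heisVec, theta, lowerMat, Matrix.mul_apply, Fin.sum_univ_three]

/-- The adjoint action of `H₁₂` on `𝔨`. -/
def adH (k : H12) (x : heisAlg) : heisAlg :=
  ⟨((k : GL (Fin 3) ℝ) : Matrix (Fin 3) (Fin 3) ℝ) * (x : Matrix (Fin 3) (Fin 3) ℝ) *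
      ((k⁻¹ : H12) : GL (Fin 3) ℝ), by
    have h : ((k : GL (Fin 3) ℝ) : Matrix (Fin 3) (Fin 3) ℝ) = heisMat (coordH k) :=
      IsLowerUnitriangular.eq_heisMat k.2
    have h' : (((k⁻¹ : H12) : GL (Fin 3) ℝ) : Matrix (Fin 3) (Fin 3) ℝ) =
        heisMat (coordH k⁻¹) := IsLowerUnitriangular.eq_heisMat (k⁻¹).2
    have hx : ∀ i j, i ≤ j → (x : Matrix (Fin 3) (Fin 3) ℝ) i j = 0 := x.2
    rw [h, h']
    have h00 := hx 0 0 le_rfl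
    have h11 := hx 1 1 le_rfl
    have h22 := hx 2 2 le_rfl
    have h01 := hx 0 1 (by decide)
    have h02 := hx 0 2 (by decide)
    have h12 := hx 1 2 (by decide)
    intro i j hij
    fin_cases i <;> fin_cases j <;>
      simp [heisMat, Matrix.mul_apply, Matrix.vecMul, dotProduct, Fin.sum_univ_three,
        h00, h11, h22, h01, h02, h12] at hij ⊢⟩

/-! ### `PGL(4, ℝ)`, its parabolic subgroup `P₁` and their Lie algebras -/

/-- Index set of `(1, 3)`-block matrices. -/
abbrev Idx : Type := Unit ⊕ Fin 3

/-- The Lie algebra `𝔤 = 𝔰𝔩(4, ℝ)` of `PGL(4, ℝ)`. -/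
abbrev sl4 : LieSubalgebra ℝ (Matrix Idx Idx ℝ) := LieAlgebra.SpecialLinear.sl Idx ℝ

/-- `PGL(4, ℝ)`, written with `(1, 3)`-block matrices. -/
abbrev PGL4 : Type := Matrix.ProjGenLinGroup Idx ℝ

/-- The quotient topology on `PGL(4, ℝ)`. -/
instance : TopologicalSpace PGL4 :=
  TopologicalSpace.coinduced (fun g : GL Idx ℝ => (Matrix.ProjGenLinGroup.mk g : PGL4)) inferInstance

/-- The class in `PGL(4, ℝ)` of an invertible matrix. -/
abbrev toPGL (g : GL Idx ℝ) : PGL4 := Matrix.ProjGenLinGroup.mk g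

/-- The parabolic subalgebra `𝔭₁` of block upper triangular matrices. -/
def parab : Submodule ℝ sl4 where
  carrier := {X | ∀ i, (X : Matrix Idx Idx ℝ) (Sum.inr i) (Sum.inl ()) = 0}
  add_mem' := by
    intro X Y hX hY i
    simp [hX i, hY i]
  zero_mem' := by intro i; rfl
  smul_mem' := by
    intro c X hX i
    simp [hX i]

/-- The nilradical `𝔭₊ = 𝔤₁` of `𝔭₁`: only the upper right block is non-zero. -/
def parabPlus : Submodule ℝ sl4 where
  carrier := {X | (X : Matrix Idx Idx ℝ) (Sum.inl ()) (Sum.inl ()) = 0 ∧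
    ∀ i s, (X : Matrix Idx Idx ℝ) (Sum.inr i) s = 0}
  add_mem' := by
    intro X Y hX hY
    refine ⟨by simp [hX.1, hY.1], fun i s => by simp [hX.2 i s, hY.2 i s]⟩
  zero_mem' := ⟨rfl, fun _ _ => rfl⟩
  smul_mem' := by
    intro c X hX
    refine ⟨by simp [hX.1], fun i s => by simp [hX.2 i s]⟩

/-- Conjugation of `𝔰𝔩(4, ℝ)` by invertible matrices. -/
def adGL : GL Idx ℝ →* Module.End ℝ sl4 where
  toFun g :=
    { toFun := fun X => ⟨(g : Matrix Idx Idx ℝ) * (X : Matrix Idx Idx ℝ) *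
          ((g⁻¹ : GL Idx ℝ) : Matrix Idx Idx ℝ), by
        have hX : Matrix.trace (X : Matrix Idx Idx ℝ) = 0 := X.2
        change Matrix.trace ((g : Matrix Idx Idx ℝ) * (X : Matrix Idx Idx ℝ) *
          ((g⁻¹ : GL Idx ℝ) : Matrix Idx Idx ℝ)) = 0
        rw [Matrix.trace_mul_comm, ← Matrix.mul_assoc, Units.inv_mul, Matrix.one_mul, hX]⟩
      map_add' := fun X Y => by
        apply Subtype.ext
        simp [Matrix.mul_add, Matrix.add_mul]
      map_smul' := fun c X => by
        apply Subtype.ext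
        simp }
  map_one' := by
    ext1 X
    apply Subtype.ext
    simp
  map_mul' g h := by
    ext1 X
    apply Subtype.ext
    simp [mul_inv_rev, Matrix.mul_assoc]

/-- The adjoint action of `PGL(4, ℝ)` on `𝔰𝔩(4, ℝ)`. -/
def adPGL : PGL4 →* Module.End ℝ sl4 :=
  Matrix.ProjGenLinGroup.lift adGL (by
    ext1 u
    ext1 X
    apply Subtype.ext
    simp only [MonoidHom.comp_apply, MonoidHom.one_apply, Module.End.one_apply]
    change (Matrix.scalar Idx (u : ℝ)) * (X : Matrix Idx Idx ℝ) *
      (((Matrix.GeneralLinearGroup.scalar Idx u)⁻¹ : GL Idx ℝ) : Matrix Idx Idx ℝ) = X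
    rw [(Matrix.scalar_commute (u : ℝ) (fun r => Commute.all _ r) (X : Matrix Idx Idx ℝ)).eq,
      Matrix.mul_assoc]
    change (X : Matrix Idx Idx ℝ) *
      (((Matrix.GeneralLinearGroup.scalar Idx u : GL Idx ℝ) : Matrix Idx Idx ℝ) *
      (((Matrix.GeneralLinearGroup.scalar Idx u)⁻¹ : GL Idx ℝ) : Matrix Idx Idx ℝ)) = X
    rw [Units.mul_inv, Matrix.mul_one])

/-- Block upper triangular invertible matrices. -/
def blockUpper : Subgroup (GL Idx ℝ) where
  carrier := {g | ∀ i, (g : Matrix Idx Idx ℝ) (Sum.inr i) (Sum.inl ()) = 0}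
  one_mem' := by intro i; simp
  mul_mem' := by
    intro g h hg hh i
    have hg' := hg i
    have hh' : ∀ j, h.val (Sum.inr j) (Sum.inl ()) = 0 := hh
    simp [Matrix.mul_apply, hg', hh']
  inv_mem' := by
    intro g hg i
    have h1 : ∀ s, ((g⁻¹ : GL Idx ℝ) * g : Matrix Idx Idx ℝ) s (Sum.inl ()) =
        ((g⁻¹ : GL Idx ℝ) : Matrix Idx Idx ℝ) s (Sum.inl ()) *
          (g : Matrix Idx Idx ℝ) (Sum.inl ()) (Sum.inl ()) := by
      intro s
      simp only [Matrix.mul_apply, Fintype.sum_sum_type, hg _, mul_zero,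
        Finset.sum_const_zero, add_zero, Finset.univ_unique, Finset.sum_singleton]
    rw [Units.inv_mul] at h1
    have h2 := h1 (Sum.inl ())
    have h3 := h1 (Sum.inr i)
    rw [Matrix.one_apply_eq] at h2
    rw [Matrix.one_apply_ne (by simp)] at h3
    rcases mul_eq_zero.1 h3.symm with h | h
    · exact h
    · rw [h, mul_zero] at h2
      exact absurd h2 one_ne_zero

/-- The parabolic subgroup `P₁` of `PGL(4, ℝ)`: classes of block upper triangular matrices. -/
def P1 : Subgroup PGL4 := blockUpper.map Matrix.ProjGenLinGroup.mk

/-- Every class in `P₁` has exactly one representative `[1, Z; 0, A]`; the pair `(Z, A)` are the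
global coordinates on `P₁`. The formula makes sense for all classes with non-zero upper left
entry. -/
def pglCoord (q : PGL4) : (Fin 3 → ℝ) × (Fin 3 → Fin 3 → ℝ) :=
  let g : Matrix Idx Idx ℝ := (Function.surjInv Matrix.ProjGenLinGroup.mk_surjective q).val
  (fun j => g (Sum.inl ()) (Sum.inr j) / g (Sum.inl ()) (Sum.inl ()),
    fun i j => g (Sum.inr i) (Sum.inr j) / g (Sum.inl ()) (Sum.inl ()))

lemma pglCoord_toPGL (g : GL Idx ℝ) :
    pglCoord (toPGL g) =
      (fun j => g.val (Sum.inl ()) (Sum.inr j) / g.val (Sum.inl ()) (Sum.inl ()),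
        fun i j => g.val (Sum.inr i) (Sum.inr j) / g.val (Sum.inl ()) (Sum.inl ())) := by
  have h := Function.surjInv_eq Matrix.ProjGenLinGroup.mk_surjective (toPGL g)
  obtain ⟨u, hu⟩ := Matrix.ProjGenLinGroup.mk_eq_mk_iff.1 h
  have hval : ∀ s t, g.val s t =
      (Function.surjInv Matrix.ProjGenLinGroup.mk_surjective (toPGL g)).val s t * (u : ℝ) := by
    intro s t
    have hu' := congrArg (fun x : GL Idx ℝ => x.val s t) hu
    rw [← hu']
    change ((Function.surjInv Matrix.ProjGenLinGroup.mk_surjective (toPGL g)).val *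
      (Matrix.scalar Idx (u : ℝ))) s t = _
    simp
  have hu0 : (u : ℝ) ≠ 0 := u.ne_zero
  simp only [pglCoord, hval]
  congr 1
  · funext j; rw [mul_div_mul_right _ _ hu0]
  · funext i j; rw [mul_div_mul_right _ _ hu0]

/-- The matrix `[1, Z; 0, A]`. -/
def normMat (c : (Fin 3 → ℝ) × (Fin 3 → Fin 3 → ℝ)) : Matrix Idx Idx ℝ :=
  Matrix.fromBlocks 1 (Matrix.of fun _ j => c.1 j) 0 (Matrix.of c.2)

lemma det_normMat (c : (Fin 3 → ℝ) × (Fin 3 → Fin 3 → ℝ)) :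
    (normMat c).det = (Matrix.of c.2).det := by
  simp [normMat, Matrix.det_fromBlocks_zero₂₁]

open Classical in
/-- The point of `P₁` with coordinates `(Z, A)`, `det A ≠ 0` (and a junk value otherwise). -/
def pointP (c : (Fin 3 → ℝ) × (Fin 3 → Fin 3 → ℝ)) : P1 :=
  if h : (Matrix.of c.2).det ≠ 0 then
    ⟨toPGL (Matrix.GeneralLinearGroup.mkOfDetNeZero (normMat c) (by rwa [det_normMat])),
      ⟨_, fun i => by simp [Matrix.GeneralLinearGroup.mkOfDetNeZero, normMat], rfl⟩⟩
  else 1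

/-- The coordinates `(Z, A)` on `P₁`. -/
def coordP (p : P1) : (Fin 3 → ℝ) × (Fin 3 → Fin 3 → ℝ) := pglCoord p

lemma coordP_pointP {c : (Fin 3 → ℝ) × (Fin 3 → Fin 3 → ℝ)} (h : (Matrix.of c.2).det ≠ 0) :
    coordP (pointP c) = c := by
  rw [pointP, dif_pos h, coordP, pglCoord_toPGL]
  simp [Matrix.GeneralLinearGroup.mkOfDetNeZero, normMat]

lemma blockUpper_ne_zero {g : GL Idx ℝ} (hg : g ∈ blockUpper) :
    g.val (Sum.inl ()) (Sum.inl ()) ≠ 0 := by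
  intro h
  have h0 : ∀ s, g.val s (Sum.inl ()) = 0 := by
    rintro (⟨⟩ | i)
    · exact h
    · exact hg i
  have h1 := congrFun (congrFun g.inv_mul (Sum.inl ())) (Sum.inl ())
  rw [Matrix.mul_apply] at h1
  simp [h0] at h1

lemma blockUpper_eq {g : GL Idx ℝ} (hg : g ∈ blockUpper) :
    g.val = g.val (Sum.inl ()) (Sum.inl ()) • normMat (pglCoord (toPGL g)) := by
  have h0 := blockUpper_ne_zero hg
  rw [pglCoord_toPGL]
  ext s t
  rcases s with ⟨⟩ | i <;> rcases t with ⟨⟩ | j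
  · simp [normMat]
  · simp [normMat]; field_simp
  · simpa [normMat] using hg i
  · simp [normMat]; field_simp

lemma det_coordP (p : P1) : (Matrix.of (coordP p).2).det ≠ 0 := by
  obtain ⟨_, g, hg, rfl⟩ := p
  have h := blockUpper_eq hg
  have hd : g.val.det ≠ 0 := (Matrix.isUnit_iff_isUnit_det _).1 g.isUnit |>.ne_zero
  rw [h, Matrix.det_smul, det_normMat] at hd
  exact (mul_ne_zero_iff.1 hd).2

lemma pointP_coordP (p : P1) : pointP (coordP p) = p := by
  have hdet := det_coordP p
  obtain ⟨_, g, hg, rfl⟩ := p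
  rw [pointP, dif_pos hdet]
  apply Subtype.ext
  change toPGL _ = toPGL g
  rw [toPGL, toPGL, Matrix.ProjGenLinGroup.mk_eq_mk_iff]
  refine ⟨Units.mk0 _ (blockUpper_ne_zero hg), Units.ext ?_⟩
  change normMat (pglCoord (toPGL g)) * Matrix.scalar Idx (g.val (Sum.inl ()) (Sum.inl ())) = g.val
  conv_rhs => rw [blockUpper_eq hg]
  ext s t
  simp [mul_comm]

/-! ### Extensions of `(H₁₂, H)` to `(PGL(4, ℝ), P₁)` -/

/-- The Lie algebra `𝔥` of a closed subgroup `H` of `H₁₂`. -/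
def isotropyAlg (H : Subgroup H12) : Set heisAlg :=
  {x | ∀ t : ℝ, ∃ h : H, ((h : H12) : GL (Fin 3) ℝ) =
    expGL (t • (x : Matrix (Fin 3) (Fin 3) ℝ))}

/-- The pair `(α, i)` is an extension of `(H₁₂, H)` to `(PGL(4, ℝ), P₁)`. -/
structure IsExtension (H : Subgroup H12) (i : H →* P1) (α : heisAlg →ₗ[ℝ] sl4) : Prop where
  /-- `i` is an injective Lie group homomorphism. -/
  continuous : Continuous i
  injective : Function.Injective i
  /-- `α ∘ Ad(h) = Ad(i(h)) ∘ α` for all `h ∈ H`. -/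
  equivariant : ∀ (h : H) (x : heisAlg), α (adH h x) = adPGL (i h) (α x)
  /-- `α|_𝔥 = di`, that is, `i (exp (t x)) = exp (t α(x))` for `x ∈ 𝔥`. -/
  differential : ∀ x ∈ isotropyAlg H, ∀ (t : ℝ) (h : H),
    ((h : H12) : GL (Fin 3) ℝ) = expGL (t • (x : Matrix (Fin 3) (Fin 3) ℝ)) →
      (i h : PGL4) = toPGL (expGL (t • (α x : Matrix Idx Idx ℝ)))
  /-- `α(𝔨/𝔥) = 𝔤/𝔭`: the induced map is well defined and injective, and it is surjective. -/
  mem_parab_iff : ∀ x, α x ∈ parab ↔ x ∈ isotropyAlg H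
  surjective : ∀ X : sl4, ∃ x, X - α x ∈ parab

/-- `κ` is the curvature of the extension `α`, seen as a function of elements of `𝔤`:
`κ(α(x) + 𝔭, α(y) + 𝔭) = [α(x), α(y)] - α([x, y])`. -/
def IsExtensionCurvature (α : heisAlg →ₗ[ℝ] sl4) (κ : sl4 → sl4 → sl4) : Prop :=
  ∀ (x y : heisAlg), ∀ U ∈ parab, ∀ V ∈ parab, κ (α x + U) (α y + V) = ⁅α x, α y⁆ - α ⁅x, y⁆

/-- The normalization condition on an element `κ` of `∧²(𝔤/𝔭)* ⊗ 𝔤`. Here `Xᵢ` represent a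
basis of `𝔤/𝔭` and `Zᵢ ∈ 𝔭₊` form the basis dual to it with respect to the Killing form. -/
def IsNormalCurvature (κ : sl4 → sl4 → sl4) : Prop :=
  ∀ (B : Fin 3 → sl4) (Z : Fin 3 → sl4), (∀ i, Z i ∈ parabPlus) →
    (∀ i j, killingForm ℝ sl4 (Z i) (B j) = if i = j then 1 else 0) →
    ∀ X : sl4, (2 : ℝ) • ∑ i, ⁅Z i, κ X (B i)⁆ - ∑ i, κ ⁅Z i, X⁆ (B i) = 0

/-- `(α, i)` is a normal extension of `(H₁₂, H)` to `(PGL(4, ℝ), P₁)`. -/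
def IsNormalExtension (H : Subgroup H12) (i : H →* P1) (α : heisAlg →ₗ[ℝ] sl4) : Prop :=
  IsExtension H i α ∧ ∃ κ, IsExtensionCurvature α κ ∧ IsNormalCurvature κ

/-! ### Cartan connections on the bundle `H₁₂ × P₁` -/

/-- The trivial principal `P₁`-bundle over `H₁₂`. -/
abbrev Bundle : Type := H12 × P1

/-- The vector space in which the global coordinates `(y, (Z, A))` of the bundle take values; it
serves as the tangent space at each point. -/
abbrev Model : Type := (Fin 3 → ℝ) × ((Fin 3 → ℝ) × (Fin 3 → Fin 3 → ℝ))

/-- The global chart of `H₁₂ × P₁`. -/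
def chart (u : Bundle) : Model := (coordH u.1, coordP u.2)

/-- The open image of the global chart. -/
def chartRange : Set Model := {e | (Matrix.of e.2.2).det ≠ 0}

/-- The inverse of the global chart, on `chartRange`. -/
def chartInv (e : Model) : Bundle := (pointH e.1, pointP e.2)

lemma chart_mem (u : Bundle) : chart u ∈ chartRange := det_coordP u.2

lemma chartInv_chart (u : Bundle) : chartInv (chart u) = u :=
  Prod.ext (pointH_coordH u.1) (pointP_coordP u.2)

lemma chart_chartInv {e : Model} (he : e ∈ chartRange) : chart (chartInv e) = e :=
  Prod.ext (coordH_pointH e.1) (coordP_pointP he)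

/-- The tangent map at `u` of a map of `H₁₂ × P₁` to itself. -/
def tangentMap (f : Bundle → Bundle) (u : Bundle) : Model →L[ℝ] Model :=
  fderiv ℝ (fun e => chart (f (chartInv e))) (chart u)

/-- The principal right action of `p ∈ P₁`. -/
def rightAct (p : P1) (u : Bundle) : Bundle := (u.1, u.2 * p)

/-- The left action of `k ∈ H₁₂`. -/
def leftAct (k : H12) (u : Bundle) : Bundle := (k * u.1, u.2)

/-- The fundamental vector field of `X ∈ 𝔭₁`, `u ↦ d/dt|₀ u · exp(tX)`. -/
def fundamentalField (X : sl4) (u : Bundle) : Model :=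
  deriv (fun t : ℝ => ((coordH u.1,
    pglCoord ((u.2 : PGL4) * toPGL (expGL (t • (X : Matrix Idx Idx ℝ))))) : Model)) 0

/-- A (smooth) Cartan connection of type `(PGL(4, ℝ), P₁)` on `H₁₂ × P₁ → H₁₂`. -/
structure CartanConnection where
  /-- The `𝔤`-valued one-form. -/
  form : Bundle → Model →ₗ[ℝ] sl4
  smooth : ∀ (v : Model) (s t : Idx),
    ContDiffOn ℝ (⊤ : ℕ∞) (fun e => (form (chartInv e) v : Matrix Idx Idx ℝ) s t) chartRange
  /-- Absolute parallelism. -/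
  bijective : ∀ u, Function.Bijective (form u)
  /-- `(rᵖ)^* ω = Ad(p⁻¹) ∘ ω`. -/
  equivariant : ∀ (p : P1) (u : Bundle) (v : Model),
    form (rightAct p u) (tangentMap (rightAct p) u v) = adPGL ((p⁻¹ : P1) : PGL4) (form u v)
  /-- Fundamental vector fields are reproduced. -/
  reproduces : ∀ X ∈ parab, ∀ u, form u (fundamentalField X u) = X

namespace CartanConnection

/-- The pullback of `ω` along the section `τ : k ↦ (k, e)`. -/
def pullback (ω : CartanConnection) (k : H12) (v : Fin 3 → ℝ) : sl4 :=
  ω.form (k, 1) (fderiv ℝ (fun y => chart (pointH y, 1)) (coordH k) v)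

/-- `ω` is invariant under the left action of `H₁₂`. -/
def IsInvariant (ω : CartanConnection) : Prop :=
  ∀ (k : H12) (u : Bundle) (v : Model),
    ω.form (leftAct k u) (tangentMap (leftAct k) u v) = ω.form u v

/-- The constant vector field `ω⁻¹(X)`. -/
def constField (ω : CartanConnection) (X : sl4) (u : Bundle) : Model :=
  (LinearEquiv.ofBijective (ω.form u) (ω.bijective u)).symm X

/-- The curvature function
`κ_u(X, Y) = dω(ω⁻¹(X), ω⁻¹(Y)) + [X, Y] = [X, Y] - ω_u([ω⁻¹(X), ω⁻¹(Y)](u))`. -/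
def curvature (ω : CartanConnection) (u : Bundle) (X Y : sl4) : sl4 :=
  ⁅X, Y⁆ - ω.form u (VectorField.lieBracket ℝ (fun e => ω.constField X (chartInv e))
    (fun e => ω.constField Y (chartInv e)) (chart u))

/-- `ω` is normal. -/
def IsNormal (ω : CartanConnection) : Prop := ∀ u, IsNormalCurvature (ω.curvature u)

end CartanConnection

/-- The `(1, 3)`-block matrix with blocks `aᵏxₖ`, `Ρᵏⱼxₖ`, `xᵢ`, `Aʲᵏᵢxₖ`. Here `A j k i` stands
for `Aʲᵏᵢ` (row `i`, column `j`) and `Rho k j` for `Ρᵏⱼ` (column `j`). -/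
def adaptedMatrix (a : Fin 3 → ℝ) (A : Fin 3 → Fin 3 → Fin 3 → ℝ) (Rho : Fin 3 → Fin 3 → ℝ)
    (x : Fin 3 → ℝ) : Matrix Idx Idx ℝ :=
  Matrix.fromBlocks (Matrix.of fun _ _ => ∑ k, a k * x k)
    (Matrix.of fun _ j => ∑ k, Rho k j * x k)
    (Matrix.of fun i _ => x i)
    (Matrix.of fun i j => ∑ k, A j k i * x k)

end HeisProj

end

/-!
Identify `p ∈ P₁` with its representative `g = [1, Z; 0, A]`. Right translations of `P₁` are affine
in `(Z, A)`, and the fundamental fields at `p = 1` are explicit, so equivariance and reproduction of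
fundamental fields express a Cartan connection through its pullback along `τ`: at `(k, p)`,
`ω = Ad(g⁻¹) τ^*ω + g⁻¹ dg` modulo scalar matrices (`form_eq_pullback`, with converse
`form_eq_of`; the scalar is fixed by the trace).

Since left translations act only on the `H₁₂` factor, invariance of `ω` is therefore invariance of
`τ^*ω`, that is, constancy of its coefficients in the left-invariant coframe
(`isInvariant_iff_const`).

In the constant case put `α = (τ^*ω)` at the identity, so that `τ^*ω = α ∘ ω_{H₁₂}`. Its lower left
block is the identity, which makes it an extension (`isExtension_bot`). For the curvature, the
equation `ω(ξ) = X` can be solved in closed form: with `x` the lower part of the first column of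
`gX`, the `H₁₂`-component of `ξ` is the left-invariant field of `x`, and the `P₁`-component is
`dg = gX - α(x)g + c g`, where the scalar `c` keeps the upper left entry of `g` equal to `1`. This
field is polynomial in the coordinates, and its Lie brackets at the base point can be computed
directly (`fderiv_explicitField`). The result is that the curvature function of `ω` there is
`(X, Y) ↦ [α(x), α(y)] - α([x, y])`, with `x`, `y` the lower first columns of `X`, `Y`
(`curvature_eq`). In particular it is horizontal and equals the curvature of `α`, so normality of
`ω` at that one point is normality of `α`.
-/

namespace HeisProj

open scoped Matrix.Norms.Operator

/-! ### Coordinates on `H₁₂` and `P₁` -/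

/-- Coordinates of the product in `H₁₂`; affine in the second factor. -/
def heisMul (y z : Fin 3 → ℝ) : Fin 3 → ℝ := ![y 0 + z 0, y 1 + z 1, y 2 + z 2 + y 1 * z 0]

lemma coordH_mul (k l : H12) : coordH (k * l) = heisMul (coordH k) (coordH l) := by
  conv_lhs => rw [← pointH_coordH k, ← pointH_coordH l]
  change heisCoord (heisMat _ * heisMat _) = _
  rw [heisMat_mul, heisCoord_heisMat]; rfl

lemma coordH_one : coordH 1 = 0 := by
  ext i; fin_cases i <;> simp [coordH, heisCoord]

/-- The derivative of left translation by the point with coordinates `y`, in coordinates. It does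
not depend on the base point; at the identity, it sends `x` to the value at `y` of the
left-invariant field `∑ xᵢ Xᵢ`. -/
def heisMulDeriv (y : Fin 3 → ℝ) : (Fin 3 → ℝ) →ₗ[ℝ] (Fin 3 → ℝ) where
  toFun v := ![v 0, v 1, v 2 + y 1 * v 0]
  map_add' u v := by ext i; fin_cases i <;> simp; ring
  map_smul' c v := by ext i; fin_cases i <;> simp; ring

lemma heisMul_eq (y z : Fin 3 → ℝ) : heisMul y z = heisMulDeriv y z + y := by
  ext i; fin_cases i <;> simp [heisMul, heisMulDeriv] <;> ring

/-- The left-invariant frame at `k`, applied to constant coefficients, is dual to `theta k`. -/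
lemma theta_heisMulDeriv (k : H12) (x : Fin 3 → ℝ) :
    theta k (heisMulDeriv (coordH k) x) = x := by
  ext i; fin_cases i <;> simp [theta, heisMulDeriv]

lemma heisVec_heisCoord (x : heisAlg) : heisVec (heisCoord x) = x := by
  have hx : ∀ i j, i ≤ j → (x : Matrix (Fin 3) (Fin 3) ℝ) i j = 0 := x.2
  apply Subtype.ext
  ext i j
  fin_cases i <;> fin_cases j <;> simp [heisVec, lowerMat, heisCoord] <;>
    exact (hx _ _ (by decide)).symm

lemma heisCoord_heisVec (x : Fin 3 → ℝ) : heisCoord (heisVec x) = x := by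
  ext i; fin_cases i <;> simp [heisVec, lowerMat, heisCoord]

/-- `heisVec` as a linear map. -/
def heisVecLin : (Fin 3 → ℝ) →ₗ[ℝ] heisAlg where
  toFun := heisVec
  map_add' u v := by
    apply Subtype.ext; ext i j
    fin_cases i <;> fin_cases j <;> simp [heisVec, lowerMat]
  map_smul' c v := by
    apply Subtype.ext; ext i j
    fin_cases i <;> fin_cases j <;> simp [heisVec, lowerMat]

/-- `heisCoord` on the Lie algebra as a linear map. -/
def heisCoordLin : heisAlg →ₗ[ℝ] (Fin 3 → ℝ) where
  toFun x := heisCoord x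
  map_add' u v := by ext i; fin_cases i <;> simp [heisCoord]
  map_smul' c v := by ext i; fin_cases i <;> simp [heisCoord]

/-- The differential of `normMat`. -/
def dNormMat : ((Fin 3 → ℝ) × (Fin 3 → Fin 3 → ℝ)) →ₗ[ℝ] Matrix Idx Idx ℝ where
  toFun w := Matrix.fromBlocks 0 (Matrix.of fun _ j => w.1 j) 0 (Matrix.of w.2)
  map_add' u v := by
    ext (s | s) (t | t) <;> simp
  map_smul' c v := by
    ext (s | s) (t | t) <;> simp

lemma normMat_eq (c : (Fin 3 → ℝ) × (Fin 3 → Fin 3 → ℝ)) :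
    normMat c = Matrix.fromBlocks 1 0 0 0 + dNormMat c := by
  ext (s | s) (t | t) <;> simp [normMat, dNormMat]

/-- The coordinates of a matrix outside its first column, a left inverse of `dNormMat`. -/
def offCol : Matrix Idx Idx ℝ →ₗ[ℝ] ((Fin 3 → ℝ) × (Fin 3 → Fin 3 → ℝ)) where
  toFun M := (fun j => M (Sum.inl ()) (Sum.inr j), fun i j => M (Sum.inr i) (Sum.inr j))
  map_add' _ _ := rfl
  map_smul' _ _ := rfl

@[simp] lemma offCol_fst (M : Matrix Idx Idx ℝ) (j : Fin 3) :
    (offCol M).1 j = M (Sum.inl ()) (Sum.inr j) := rfl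

@[simp] lemma offCol_snd (M : Matrix Idx Idx ℝ) (i j : Fin 3) :
    (offCol M).2 i j = M (Sum.inr i) (Sum.inr j) := rfl

lemma offCol_dNormMat (w) : offCol (dNormMat w) = w := rfl

lemma dNormMat_offCol {M : Matrix Idx Idx ℝ} (h : ∀ s, M s (Sum.inl ()) = 0) :
    dNormMat (offCol M) = M := by
  ext (s | s) (t | t) <;> simp [dNormMat, h]

/-- The lower part of the first column of a matrix. It represents the class in
`𝔤/𝔭₁` of an element of `𝔤`. -/
def lowerCol : Matrix Idx Idx ℝ →ₗ[ℝ] (Fin 3 → ℝ) where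
  toFun M := fun i => M (Sum.inr i) (Sum.inl ())
  map_add' _ _ := rfl
  map_smul' _ _ := rfl

@[simp] lemma lowerCol_apply (M : Matrix Idx Idx ℝ) (i : Fin 3) :
    lowerCol M i = M (Sum.inr i) (Sum.inl ()) := rfl

/-- The upper left entry of a matrix. -/
def topEntry : Matrix Idx Idx ℝ →ₗ[ℝ] ℝ where
  toFun M := M (Sum.inl ()) (Sum.inl ())
  map_add' _ _ := rfl
  map_smul' _ _ := rfl

@[simp] lemma topEntry_apply (M : Matrix Idx Idx ℝ) :
    topEntry M = M (Sum.inl ()) (Sum.inl ()) := rfl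

/-- The invertible matrix `[1, Z; 0, A]` representing `p ∈ P₁`. -/
noncomputable def normGL (p : P1) : GL Idx ℝ :=
  Matrix.GeneralLinearGroup.mkOfDetNeZero (normMat (coordP p))
    (by rw [det_normMat]; exact det_coordP p)

lemma normGL_val (p : P1) : (normGL p).val = normMat (coordP p) := rfl

lemma toPGL_normGL (p : P1) : toPGL (normGL p) = p := by
  conv_rhs => rw [← pointP_coordP p, pointP, dif_pos (det_coordP p)]
  rfl

lemma pglCoord_eq {g : GL Idx ℝ} {c} (h : g.val = normMat c) : pglCoord (toPGL g) = c := by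
  rw [pglCoord_toPGL, h]
  simp [normMat]

lemma coordP_mul (p q : P1) :
    coordP (p * q) = offCol (normMat (coordP p) * normMat (coordP q)) := by
  have h : ((p * q : P1) : PGL4) = toPGL (normGL p * normGL q) := by
    rw [Subgroup.coe_mul, ← toPGL_normGL p, ← toPGL_normGL q]
    exact (map_mul Matrix.ProjGenLinGroup.mk _ _).symm
  rw [coordP, h]
  apply pglCoord_eq
  rw [Units.val_mul, normGL_val, normGL_val]
  ext (s | s) (t | t) <;> simp [normMat, Matrix.mul_apply]

lemma coordP_one : coordP 1 = offCol 1 := by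
  have h : ((1 : P1) : PGL4) = toPGL 1 := by simp [toPGL]
  rw [coordP, h]
  apply pglCoord_eq
  ext (s | s) (t | t) <;> simp [normMat, Matrix.one_apply]

lemma normMat_coordP_one : normMat (coordP 1) = 1 := by
  rw [coordP_one]
  ext (s | s) (t | t) <;> simp [normMat, Matrix.one_apply]

lemma adPGL_apply (p : P1) (X : sl4) :
    (adPGL ((p⁻¹ : P1) : PGL4) X : Matrix Idx Idx ℝ) =
      ((normGL p)⁻¹ : GL Idx ℝ).val * X.1 * (normGL p).val := by
  have h : ((p⁻¹ : P1) : PGL4) = toPGL (normGL p)⁻¹ := by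
    rw [Subgroup.coe_inv, ← toPGL_normGL p]
    exact (map_inv Matrix.ProjGenLinGroup.mk _).symm
  rw [h, adPGL, Matrix.ProjGenLinGroup.lift_mk]
  simp [adGL]

/-! ### Tangent maps in the global chart -/

lemma isOpen_chartRange : IsOpen chartRange := by
  refine isOpen_ne_fun (Continuous.matrix_det ?_) continuous_const
  exact continuous_snd.comp continuous_snd

lemma eventually_mem_chartRange (u : Bundle) : ∀ᶠ e in nhds (chart u), e ∈ chartRange :=
  isOpen_chartRange.mem_nhds (chart_mem u)

/-- A map which is affine in the global chart has the expected tangent map. -/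
lemma tangentMap_of_affine {f : Bundle → Bundle} (T : Model →ₗ[ℝ] Model) (b : Model)
    (h : ∀ e ∈ chartRange, chart (f (chartInv e)) = T e + b) (u : Bundle) (v : Model) :
    tangentMap f u v = T v := by
  have h1 : (fun e => chart (f (chartInv e))) =ᶠ[nhds (chart u)]
      fun e => T.toContinuousLinearMap e + b := by
    filter_upwards [eventually_mem_chartRange u] with e he using h e he
  rw [tangentMap, h1.fderiv_eq, fderiv_add_const, ContinuousLinearMap.fderiv]
  rfl

lemma tangentMap_leftAct (k : H12) (u : Bundle) (v : Model) :
    tangentMap (leftAct k) u v = (heisMulDeriv (coordH k) v.1, v.2) := by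
  refine tangentMap_of_affine ((heisMulDeriv (coordH k)).prodMap LinearMap.id)
    (coordH k, 0) (fun e he => ?_) u v
  have h := chart_chartInv he
  have h1 : coordH (pointH e.1) = e.1 := congrArg Prod.fst h
  have h2 : coordP (pointP e.2) = e.2 := congrArg Prod.snd h
  ext1
  · simp [chart, leftAct, chartInv, coordH_mul, h1, heisMul_eq]
  · simp [chart, leftAct, chartInv, h2]

/-- Right multiplication by the matrix of `p`, on tangent vectors to `P₁`. -/
noncomputable def rightMulDeriv (p : P1) : Model →ₗ[ℝ] Model :=
  LinearMap.id.prodMap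
    (offCol ∘ₗ LinearMap.mulRight ℝ (normMat (coordP p)) ∘ₗ dNormMat)

lemma tangentMap_rightAct (p : P1) (u : Bundle) (v : Model) :
    tangentMap (rightAct p) u v = (v.1, offCol (dNormMat v.2 * normMat (coordP p))) := by
  refine tangentMap_of_affine (rightMulDeriv p)
    (0, offCol (Matrix.fromBlocks 1 0 0 0 * normMat (coordP p))) (fun e he => ?_) u v
  have h := chart_chartInv he
  have h1 : coordH (pointH e.1) = e.1 := congrArg Prod.fst h
  have h2 : coordP (pointP e.2) = e.2 := congrArg Prod.snd h
  ext1
  · simp [chart, rightAct, chartInv, rightMulDeriv, h1]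
  · change coordP (pointP e.2 * p) = _
    rw [coordP_mul, h2, normMat_eq, add_mul, add_comm, map_add]
    rfl

/-- The tangent map of `τ` is `v ↦ (v, 0)`. -/
lemma pullback_eq (ω : CartanConnection) (k : H12) (v : Fin 3 → ℝ) :
    ω.pullback k v = ω.form (k, 1) (v, 0) := by
  have h : (fun y => chart (pointH y, 1)) = fun y => (y, coordP 1) := by
    funext y; simp [chart, coordH_pointH]
  have h' : HasFDerivAt (fun y : Fin 3 → ℝ => (y, coordP 1))
      ((ContinuousLinearMap.id ℝ _).prod 0) (coordH k) :=
    (hasFDerivAt_id _).prodMk (hasFDerivAt_const _ _)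
  rw [CartanConnection.pullback, h, h'.fderiv]
  rfl

/-- At the identity of `P₁`, the chart projects a matrix to its off-column part modulo scalars:
normalizing the upper left entry of `exp(tX)` to `1` subtracts `X₀₀ · 1` to first order. -/
lemma fundamentalField_one (X : sl4) (k : H12) :
    fundamentalField X (k, 1) =
      (0, offCol (X.1 - X.1 (Sum.inl ()) (Sum.inl ()) • 1)) := by
  have hexp : HasDerivAt (fun t : ℝ => NormedSpace.exp (t • X.1)) X.1 0 := by
    have h := hasDerivAt_exp_smul_const (𝕂 := ℝ) X.1 0
    rw [zero_smul, NormedSpace.exp_zero, one_mul] at h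
    exact h
  have hent : ∀ s t, HasDerivAt (fun r : ℝ => NormedSpace.exp (r • X.1) s t) (X.1 s t) 0 :=
    fun s t => hasDerivAt_pi.1 (hasDerivAt_pi.1 hexp s) t
  have hquot : ∀ s t, HasDerivAt (fun r : ℝ => NormedSpace.exp (r • X.1) s t /
      NormedSpace.exp (r • X.1) (Sum.inl ()) (Sum.inl ()))
      ((X.1 - X.1 (Sum.inl ()) (Sum.inl ()) • 1) s t) 0 := by
    intro s t
    have h := (hent s t).div (hent (Sum.inl ()) (Sum.inl ())) (by simp)
    have hval : (X.1 s t * NormedSpace.exp ((0 : ℝ) • X.1) (Sum.inl ()) (Sum.inl ()) -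
        NormedSpace.exp ((0 : ℝ) • X.1) s t * X.1 (Sum.inl ()) (Sum.inl ())) /
        NormedSpace.exp ((0 : ℝ) • X.1) (Sum.inl ()) (Sum.inl ()) ^ 2 =
        (X.1 - X.1 (Sum.inl ()) (Sum.inl ()) • 1) s t := by
      simp [mul_comm]
    rw [hval] at h
    exact h
  have hfun : (fun t : ℝ => ((coordH k,
      pglCoord (((1 : P1) : PGL4) * toPGL (expGL (t • (X : Matrix Idx Idx ℝ))))) : Model)) =
      fun r => (coordH k, (fun j => NormedSpace.exp (r • X.1) (Sum.inl ()) (Sum.inr j) /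
        NormedSpace.exp (r • X.1) (Sum.inl ()) (Sum.inl ()),
        fun i j => NormedSpace.exp (r • X.1) (Sum.inr i) (Sum.inr j) /
        NormedSpace.exp (r • X.1) (Sum.inl ()) (Sum.inl ()))) := by
    funext r
    rw [OneMemClass.coe_one, one_mul, pglCoord_toPGL]
    rfl
  have key := (hasDerivAt_const (0 : ℝ) (coordH k)).prodMk
    ((hasDerivAt_pi.2 fun j => hquot (Sum.inl ()) (Sum.inr j)).prodMk
      (hasDerivAt_pi.2 fun i => hasDerivAt_pi.2 fun j => hquot (Sum.inr i) (Sum.inr j)))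
  rw [fundamentalField]
  change deriv (fun t : ℝ => ((coordH k,
      pglCoord (((1 : P1) : PGL4) * toPGL (expGL (t • (X : Matrix Idx Idx ℝ))))) : Model)) 0 = _
  rw [hfun]
  exact key.deriv

/-! ### A Cartan connection in terms of its pullback along `τ` -/

lemma trace_one_ne_zero : Matrix.trace (1 : Matrix Idx Idx ℝ) ≠ 0 := by
  simp [Matrix.trace_one]

/-- Two elements of `𝔰𝔩(4, ℝ)` which agree modulo scalars are equal. -/
lemma sl4_ext_of_sub_smul_one {X Y : sl4} {c : ℝ} (h : X.1 = Y.1 + c • 1) : X = Y := by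
  have hX : Matrix.trace X.1 = 0 := X.2
  have hY : Matrix.trace Y.1 = 0 := Y.2
  have h1 := congrArg Matrix.trace h
  rw [Matrix.trace_add, Matrix.trace_smul, hX, hY, zero_add, smul_eq_mul] at h1
  have hc : c = 0 := (mul_eq_zero.1 h1.symm).resolve_right trace_one_ne_zero
  apply Subtype.ext
  simpa [hc] using h

/-- On vertical vectors at the identity of `P₁` the form is the identification of the tangent
space of `P₁` with `𝔭₁`, modulo scalar matrices. -/
lemma form_vertical (ω : CartanConnection) (k : H12) (w) :
    ∃ c : ℝ, (ω.form (k, 1) (0, w)).1 = dNormMat w + c • 1 := by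
  -- the scalar that makes `dNormMat w` traceless, as the size of the matrices is `4`
  set c : ℝ := -(Matrix.trace (dNormMat w) / 4) with hc
  have htr : Matrix.trace (dNormMat w + c • 1) = 0 := by
    rw [Matrix.trace_add, Matrix.trace_smul, Matrix.trace_one]
    simp [hc]
  let X : sl4 := ⟨dNormMat w + c • 1, htr⟩
  have hX : X ∈ parab := by
    intro i
    simp [X, dNormMat]
  have h := ω.reproduces X hX (k, 1)
  have h0 : X.1 - X.1 (Sum.inl ()) (Sum.inl ()) • 1 = dNormMat w := by
    simp [X, dNormMat]
  rw [fundamentalField_one, h0, offCol_dNormMat] at h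
  exact ⟨c, by rw [h]⟩

/-- A Cartan connection is determined by its pullback `τ^*ω`: with `g` the matrix of `p`,
the value at `(k, p)` is `Ad(g⁻¹) τ^*ω + g⁻¹ dg` modulo scalar matrices. -/
lemma form_eq_pullback (ω : CartanConnection) (k : H12) (p : P1) (v : Fin 3 → ℝ) (w) :
    ∃ c : ℝ, normMat (coordP p) * (ω.form (k, p) (v, w)).1 =
      (ω.pullback k v).1 * normMat (coordP p) + dNormMat w + c • normMat (coordP p) := by
  set g := normGL p with hg
  have hgv : g.val = normMat (coordP p) := rfl
  -- the tangent vector at `(k, 1)` which right translation by `p` carries to `(v, w)`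
  set w' := offCol (dNormMat w * (g⁻¹).val) with hw'
  have hinv : g.val * (g⁻¹).val = 1 := g.mul_inv
  have hinv' : (g⁻¹).val * g.val = 1 := g.inv_mul
  have hw'd : dNormMat w' = dNormMat w * (g⁻¹).val := by
    refine dNormMat_offCol fun s => ?_
    have hinv0 : ∀ i, (g⁻¹).val (Sum.inr i) (Sum.inl ()) = 0 :=
      blockUpper.inv_mem (x := g) (fun i => by rw [hgv]; simp [normMat])
    rcases s with s | s <;>
      simp [dNormMat, Matrix.mul_apply, -Matrix.coe_units_inv, hinv0]
  have hT : tangentMap (rightAct p) (k, 1) (v, w') = (v, w) := by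
    rw [tangentMap_rightAct]
    change (v, offCol (dNormMat w' * normMat (coordP p))) = (v, w)
    rw [hw'd, ← hgv, mul_assoc, hinv', mul_one, offCol_dNormMat]
  have heq := ω.equivariant p (k, 1) (v, w')
  have hr : rightAct p (k, 1) = (k, p) := by simp [rightAct]
  rw [hT, hr] at heq
  obtain ⟨c, hc⟩ := form_vertical ω k w'
  refine ⟨c, ?_⟩
  have hsplit : ((v, w') : Model) = (v, 0) + (0, w') := by simp
  have hsum : (ω.form (k, 1) (v, w')).1 = (ω.pullback k v).1 + (dNormMat w' + c • 1) := by
    rw [hsplit, map_add, ← pullback_eq, ← hc]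
    rfl
  rw [heq, adPGL_apply, hsum, ← hgv, ← hg, mul_assoc, ← mul_assoc, hinv, one_mul, hw'd, add_mul,
    add_mul, mul_assoc _ _ g.val, hinv', mul_one, smul_mul_assoc, one_mul, add_assoc]

/-- An element of `𝔤` satisfying the formula of `form_eq_pullback` is the value of the form. -/
lemma form_eq_of (ω : CartanConnection) {k : H12} {p : P1} {v : Fin 3 → ℝ} {w} {X : sl4} {c : ℝ}
    (h : normMat (coordP p) * X.1 =
      (ω.pullback k v).1 * normMat (coordP p) + dNormMat w + c • normMat (coordP p)) :
    ω.form (k, p) (v, w) = X := by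
  obtain ⟨c', hc'⟩ := form_eq_pullback ω k p v w
  refine sl4_ext_of_sub_smul_one (c := c' - c) ?_
  refine (normGL p).isUnit.mul_left_cancel ?_
  rw [normGL_val, hc', mul_add, h, mul_smul_comm, mul_one, sub_smul]
  abel

/-! ### Invariance under `H₁₂` -/

lemma theta_one (v : Fin 3 → ℝ) : theta 1 v = v := by
  ext i; fin_cases i <;> simp [theta, coordH_one]

/-- `ω` is invariant if and only if its pullback along `τ` has constant coefficients with respect
to the left-invariant coframe. -/
lemma isInvariant_iff_pullback (ω : CartanConnection) :
    ω.IsInvariant ↔ ∀ k v, ω.pullback k (heisMulDeriv (coordH k) v) = ω.pullback 1 v := by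
  constructor
  · intro h k v
    have h1 := h k (1, 1) (v, 0)
    rw [tangentMap_leftAct] at h1
    simpa only [pullback_eq, leftAct, mul_one] using h1
  · rintro h k ⟨l, p⟩ ⟨v, w⟩
    -- every tangent vector at `l` is the value of a left-invariant field
    have hl : ∀ m : H12, heisMulDeriv (coordH m) (theta m v) = v := by
      intro m
      ext i; fin_cases i <;> simp [theta, heisMulDeriv]
    have hpull : ω.pullback (k * l) (heisMulDeriv (coordH k) v) = ω.pullback l v := by
      have h2 : heisMulDeriv (coordH k) v = heisMulDeriv (coordH (k * l)) (theta l v) := by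
        ext i; fin_cases i <;> simp [theta, heisMulDeriv, coordH_mul, heisMul]; ring
      rw [h2, h, ← h l, hl]
    obtain ⟨c, hc⟩ := form_eq_pullback ω l p v w
    rw [tangentMap_leftAct]
    exact form_eq_of ω (c := c) (by rw [hpull]; exact hc)

/-- The coefficients of `adaptedMatrix` are its entries on basis vectors. -/
lemma adaptedMatrix_single {a : Fin 3 → ℝ} {A : Fin 3 → Fin 3 → Fin 3 → ℝ}
    {Rho : Fin 3 → Fin 3 → ℝ} (k : Fin 3) :
    adaptedMatrix a A Rho (Pi.single k 1) (Sum.inl ()) (Sum.inl ()) = a k ∧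
    (∀ j, adaptedMatrix a A Rho (Pi.single k 1) (Sum.inl ()) (Sum.inr j) = Rho k j) ∧
    (∀ j i, adaptedMatrix a A Rho (Pi.single k 1) (Sum.inr i) (Sum.inr j) = A j k i) := by
  simp [adaptedMatrix, Pi.single_apply]

lemma isInvariant_iff_const (ω : CartanConnection)
    (a : Fin 3 → H12 → ℝ) (A : Fin 3 → Fin 3 → Fin 3 → H12 → ℝ) (Rho : Fin 3 → Fin 3 → H12 → ℝ)
    (hω : ∀ (y : H12) (v : Fin 3 → ℝ), (ω.pullback y v : Matrix Idx Idx ℝ) =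
      adaptedMatrix (fun k => a k y) (fun j k i => A j k i y) (fun k j => Rho k j y) (theta y v)) :
    ω.IsInvariant ↔ (∀ k, ∃ c, ∀ y, a k y = c) ∧ (∀ j k i, ∃ c, ∀ y, A j k i y = c) ∧
        (∀ k j, ∃ c, ∀ y, Rho k j y = c) := by
  rw [isInvariant_iff_pullback]
  constructor
  · intro h
    have key : ∀ (k : Fin 3) (y : H12),
        adaptedMatrix (fun k => a k y) (fun j k i => A j k i y) (fun k j => Rho k j y)
          (Pi.single k 1) =
        adaptedMatrix (fun k => a k 1) (fun j k i => A j k i 1) (fun k j => Rho k j 1)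
          (Pi.single k 1) := by
      intro k y
      have h1 := congrArg Subtype.val (h y (Pi.single k 1))
      rwa [hω, hω, theta_heisMulDeriv, theta_one] at h1
    refine ⟨fun k => ⟨a k 1, fun y => ?_⟩, fun j k i => ⟨A j k i 1, fun y => ?_⟩,
      fun k j => ⟨Rho k j 1, fun y => ?_⟩⟩
    · have h1 := congrFun (congrFun (key k y) (Sum.inl ())) (Sum.inl ())
      rwa [(adaptedMatrix_single k).1, (adaptedMatrix_single k).1] at h1
    · have h1 := congrFun (congrFun (key k y) (Sum.inr i)) (Sum.inr j)
      rwa [(adaptedMatrix_single k).2.2, (adaptedMatrix_single k).2.2] at h1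
    · have h1 := congrFun (congrFun (key k y) (Sum.inl ())) (Sum.inr j)
      rwa [(adaptedMatrix_single k).2.1, (adaptedMatrix_single k).2.1] at h1
  · rintro ⟨ha, hA, hR⟩ k v
    choose ca hca using ha
    choose cA hcA using hA
    choose cR hcR using hR
    apply Subtype.ext
    rw [hω, hω, theta_heisMulDeriv, theta_one]
    simp only [hca, hcA, hcR]

/-! ### The curvature of an invariant Cartan connection -/

/-- `α` as a matrix-valued function of the coordinates `x` of `∑ xᵢ Xᵢ`. -/
noncomputable def coordMat (α : heisAlg →ₗ[ℝ] sl4) : (Fin 3 → ℝ) →ₗ[ℝ] Matrix Idx Idx ℝ :=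
  (sl4.toSubmodule.subtype ∘ₗ α) ∘ₗ heisVecLin

lemma coordMat_apply (α : heisAlg →ₗ[ℝ] sl4) (x : Fin 3 → ℝ) :
    coordMat α x = (α (heisVec x)).1 := rfl

/-- The `P₁`-component, as a tangent vector `dg` to matrices `[1, Z; 0, A]`, of the constant field
`ω⁻¹(X)` at a point whose `P₁`-coordinates have the matrix `g`. The multiple of `g` keeps the
upper left entry of `dg` zero. -/
noncomputable def fieldMat (α : heisAlg →ₗ[ℝ] sl4) (X g : Matrix Idx Idx ℝ) : Matrix Idx Idx ℝ :=
  g * X - coordMat α (lowerCol (g * X)) * g +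
    (topEntry (coordMat α (lowerCol (g * X))) - topEntry (g * X)) • g

/-- The constant field `ω⁻¹(X)` in the global chart, when `τ^*ω = α ∘ ω_{H₁₂}`. -/
noncomputable def explicitField (α : heisAlg →ₗ[ℝ] sl4) (X : sl4) (e : Model) : Model :=
  (heisMulDeriv e.1 (lowerCol (normMat e.2 * X.1)), offCol (fieldMat α X.1 (normMat e.2)))

/-- `fieldMat` is tangent to the matrices `[1, Z; 0, A]`. -/
lemma fieldMat_col {α : heisAlg →ₗ[ℝ] sl4}
    (hcol : ∀ x i, (α (heisVec x)).1 (Sum.inr i) (Sum.inl ()) = x i)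
    (X : Matrix Idx Idx ℝ) (c) (s : Idx) : fieldMat α X (normMat c) s (Sum.inl ()) = 0 := by
  have hg : ∀ (M : Matrix Idx Idx ℝ) (s : Idx),
      (M * normMat c) s (Sum.inl ()) = M s (Sum.inl ()) := by
    intro M s
    simp [Matrix.mul_apply, normMat]
  rcases s with ⟨⟩ | i
  · change fieldMat α X (normMat c) (Sum.inl ()) (Sum.inl ()) = 0
    have h00 : normMat c (Sum.inl ()) (Sum.inl ()) = 1 := by simp [normMat]
    rw [fieldMat, Matrix.add_apply, Matrix.sub_apply, hg]
    simp [h00]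
  · rw [fieldMat, Matrix.add_apply, Matrix.sub_apply, hg, coordMat_apply, hcol]
    simp [normMat]

/-- The explicit field is the constant field `ω⁻¹(X)` on the image of the chart. -/
lemma constField_eq {ω : CartanConnection} {α : heisAlg →ₗ[ℝ] sl4}
    (hcol : ∀ x i, (α (heisVec x)).1 (Sum.inr i) (Sum.inl ()) = x i)
    (hα : ∀ y v, ω.pullback y v = α (maurerCartan y v)) (X : sl4) {e : Model}
    (he : e ∈ chartRange) : ω.constField X (chartInv e) = explicitField α X e := by
  rw [CartanConnection.constField, LinearEquiv.symm_apply_eq, LinearEquiv.ofBijective_apply]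
  have h := chart_chartInv he
  have h1 : coordH (pointH e.1) = e.1 := congrArg Prod.fst h
  have h2 : coordP (pointP e.2) = e.2 := congrArg Prod.snd h
  have hθ : theta (pointH e.1) (heisMulDeriv e.1 (lowerCol (normMat e.2 * X.1))) =
      lowerCol (normMat e.2 * X.1) := by
    simpa only [h1] using theta_heisMulDeriv (pointH e.1) (lowerCol (normMat e.2 * X.1))
  refine (form_eq_of ω (c := -(topEntry (coordMat α (lowerCol (normMat e.2 * X.1))) -
    topEntry (normMat e.2 * X.1))) ?_).symm
  rw [h2, dNormMat_offCol (fieldMat_col hcol _ _), hα, maurerCartan, hθ, fieldMat,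
    ← coordMat_apply, neg_smul]
  abel

/-- The derivative of a linear map between finite-dimensional spaces along a curve. -/
lemma hasDerivAt_linear_comp {E F : Type*} [NormedAddCommGroup E] [NormedSpace ℝ E]
    [FiniteDimensional ℝ E] [NormedAddCommGroup F] [NormedSpace ℝ F] (T : E →ₗ[ℝ] F)
    {f : ℝ → E} {f' : E} {t : ℝ} (h : HasDerivAt f f' t) :
    HasDerivAt (fun s => T (f s)) (T f') t :=
  T.toContinuousLinearMap.hasFDerivAt.comp_hasDerivAt t h

lemma differentiable_linear_comp {D E F : Type*} [NormedAddCommGroup D] [NormedSpace ℝ D]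
    [NormedAddCommGroup E] [NormedSpace ℝ E]
    [FiniteDimensional ℝ E] [NormedAddCommGroup F] [NormedSpace ℝ F] (T : E →ₗ[ℝ] F)
    {f : D → E} (h : Differentiable ℝ f) :
    Differentiable ℝ (fun s => T (f s)) :=
  T.toContinuousLinearMap.differentiable.comp h

lemma differentiable_explicitField (α : heisAlg →ₗ[ℝ] sl4) (X : sl4) :
    Differentiable ℝ (explicitField α X) := by
  have hg : Differentiable ℝ (fun e : Model => normMat e.2) := by
    simp only [normMat_eq]
    exact (differentiable_linear_comp dNormMat differentiable_snd).const_add _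
  have hgX : Differentiable ℝ (fun e : Model => normMat e.2 * X.1) := hg.mul_const _
  have hx := differentiable_linear_comp lowerCol hgX
  have hax := differentiable_linear_comp (coordMat α) hx
  refine Differentiable.prodMk ?_ (differentiable_linear_comp offCol ?_)
  · rw [differentiable_pi] at hx ⊢
    intro i
    have h1 : Differentiable ℝ (fun e : Model => e.1 1) :=
      (differentiable_pi.1 differentiable_fst) 1
    fin_cases i
    · exact hx 0
    · exact hx 1
    · exact (hx 2).add (h1.mul (hx 0))
  · exact (hgX.sub (hax.mul hg)).add
      (((differentiable_linear_comp topEntry hax).sub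
        (differentiable_linear_comp topEntry hgX)).smul hg)

lemma normMat_chart_one : normMat (chart (1, 1)).2 = 1 := normMat_coordP_one

lemma chart_one_fst : (chart (1, 1)).1 = 0 := coordH_one

/-- The derivative of the explicit constant field at the base point `(1, 1)`. The extra term in the
`H₁₂`-component comes from the only non-constant coefficient of the left-invariant frame. -/
lemma fderiv_explicitField (α : heisAlg →ₗ[ℝ] sl4) (Y : sl4) (h : Model) :
    fderiv ℝ (explicitField α Y) (chart (1, 1)) h =
      (lowerCol (dNormMat h.2 * Y.1) + ![0, 0, h.1 1 * lowerCol Y.1 0],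
        offCol (dNormMat h.2 * Y.1 -
          (coordMat α (lowerCol (dNormMat h.2 * Y.1)) +
            coordMat α (lowerCol Y.1) * dNormMat h.2) +
          ((topEntry (coordMat α (lowerCol Y.1)) - topEntry Y.1) • dNormMat h.2 +
            (topEntry (coordMat α (lowerCol (dNormMat h.2 * Y.1))) -
              topEntry (dNormMat h.2 * Y.1)) • 1))) := by
  have hline : HasDerivAt (fun t : ℝ => chart (1, 1) + t • h) h 0 := by
    simpa using ((hasDerivAt_id (0 : ℝ)).smul_const h).const_add (chart (1, 1))
  have hcomp : HasDerivAt (fun t : ℝ => explicitField α Y (chart (1, 1) + t • h))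
      (fderiv ℝ (explicitField α Y) (chart (1, 1)) h) 0 := by
    have h0 := (differentiable_explicitField α Y (chart (1, 1) + (0 : ℝ) • h)).hasFDerivAt
    have h1 := h0.comp_hasDerivAt 0 hline
    rw [zero_smul, add_zero] at h1
    exact h1
  have hg0 : normMat (chart (1, 1) + (0 : ℝ) • h).2 = 1 := by
    rw [zero_smul, add_zero, normMat_chart_one]
  have hg : HasDerivAt (fun t : ℝ => normMat (chart (1, 1) + t • h).2) (dNormMat h.2) 0 := by
    simp only [normMat_eq]
    exact (hasDerivAt_linear_comp (dNormMat ∘ₗ LinearMap.snd ℝ _ _) hline).const_add _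
  have hgY : HasDerivAt (fun t : ℝ => normMat (chart (1, 1) + t • h).2 * Y.1)
      (dNormMat h.2 * Y.1) 0 := hg.mul_const _
  have hx := hasDerivAt_linear_comp lowerCol hgY
  have hax := hasDerivAt_linear_comp (coordMat α) hx
  have hs := (hasDerivAt_linear_comp topEntry hax).sub (hasDerivAt_linear_comp topEntry hgY)
  have hmat := hasDerivAt_linear_comp offCol ((hgY.sub (hax.mul hg)).add (hs.smul hg))
  have hbase : HasDerivAt (fun t : ℝ => heisMulDeriv (chart (1, 1) + t • h).1
      (lowerCol (normMat (chart (1, 1) + t • h).2 * Y.1)))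
      (lowerCol (dNormMat h.2 * Y.1) + ![0, 0, h.1 1 * lowerCol Y.1 0]) 0 := by
    have h1 : HasDerivAt (fun t : ℝ => (chart (1, 1) + t • h).1 1) (h.1 1) 0 :=
      hasDerivAt_pi.1 (hasDerivAt_linear_comp (LinearMap.fst ℝ (Fin 3 → ℝ) _) hline) 1
    have hx' := hasDerivAt_pi.1 hx
    refine hasDerivAt_pi.2 fun i => ?_
    fin_cases i
    · refine (hx' 0).congr_deriv ?_
      simp
    · refine (hx' 1).congr_deriv ?_
      simp
    · refine ((hx' 2).add (h1.mul (hx' 0))).congr_deriv ?_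
      rw [hg0]
      simp [chart_one_fst]
  refine (hcomp.unique (hbase.prodMk hmat)).trans ?_
  simp only [hg0, one_mul, mul_one, Pi.sub_apply]

lemma lie_heisVec (x y : Fin 3 → ℝ) :
    ⁅heisVec x, heisVec y⁆ = heisVec ![0, 0, x 1 * y 0 - y 1 * x 0] := by
  apply Subtype.ext
  rw [LieSubalgebra.coe_bracket, Ring.lie_def]
  ext i j
  fin_cases i <;> fin_cases j <;>
    simp [heisVec, lowerMat]

/-- The curvature function of the Cartan connection given by `α`, at the base point. -/
lemma curvature_eq {ω : CartanConnection} {α : heisAlg →ₗ[ℝ] sl4}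
    (hcol : ∀ x i, (α (heisVec x)).1 (Sum.inr i) (Sum.inl ()) = x i)
    (hα : ∀ y v, ω.pullback y v = α (maurerCartan y v)) (X Y : sl4) :
    ω.curvature (1, 1) X Y =
      ⁅α (heisVec (lowerCol X.1)), α (heisVec (lowerCol Y.1))⁆ -
        α ⁅heisVec (lowerCol X.1), heisVec (lowerCol Y.1)⁆ := by
  have hev : ∀ X : sl4, (fun e => ω.constField X (chartInv e)) =ᶠ[nhds (chart (1, 1))]
      explicitField α X := by
    intro X
    filter_upwards [eventually_mem_chartRange (1, 1)] with e he using constField_eq hcol hα X he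
  -- the claim becomes a formula for the value of `ω` on the bracket of the two fields
  rw [CartanConnection.curvature, (hev X).lieBracket_vectorField_eq (hev Y),
    sub_eq_iff_eq_add, ← sub_eq_iff_eq_add']
  symm
  rw [VectorField.lieBracket, fderiv_explicitField, fderiv_explicitField]
  have hval : ∀ X : sl4, explicitField α X (chart (1, 1)) =
      (lowerCol X.1, offCol (fieldMat α X.1 1)) := by
    intro X
    rw [explicitField, normMat_chart_one, one_mul, chart_one_fst]
    congr 1
    ext i; fin_cases i <;> simp [heisMulDeriv]
  have hcol0 : ∀ (X : sl4) (s : Idx), fieldMat α X.1 1 s (Sum.inl ()) = 0 := by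
    intro X s
    rw [← normMat_coordP_one]
    exact fieldMat_col hcol X.1 _ s
  simp only [hval, dNormMat_offCol (hcol0 _)]
  set G := fieldMat α X.1 1 with hG
  set G' := fieldMat α Y.1 1 with hG'
  rw [Prod.mk_sub_mk, ← map_sub]
  refine form_eq_of ω (k := 1) (p := 1) (c :=
    -((topEntry (coordMat α (lowerCol (G * Y.1))) - topEntry (G * Y.1)) -
      (topEntry (coordMat α (lowerCol (G' * X.1))) - topEntry (G' * X.1)))) ?_
  have hmulcol : ∀ (M N : Matrix Idx Idx ℝ), (∀ s, N s (Sum.inl ()) = 0) →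
      ∀ s, (M * N) s (Sum.inl ()) = 0 := by
    intro M N hN s
    simp [Matrix.mul_apply, hN]
  -- both halves of the derivative are tangent to the matrices `[1, Z; 0, A]`
  have hcol1 : ∀ X Y : sl4, ∀ s, (fieldMat α X.1 1 * Y.1 -
          (coordMat α (lowerCol (fieldMat α X.1 1 * Y.1)) +
            coordMat α (lowerCol Y.1) * fieldMat α X.1 1) +
          ((topEntry (coordMat α (lowerCol Y.1)) - topEntry Y.1) • fieldMat α X.1 1 +
            (topEntry (coordMat α (lowerCol (fieldMat α X.1 1 * Y.1))) -
              topEntry (fieldMat α X.1 1 * Y.1)) • 1)) s (Sum.inl ()) = 0 := by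
    intro X Y s
    rcases s with ⟨⟩ | i
    · change (_ : Matrix Idx Idx ℝ) (Sum.inl ()) (Sum.inl ()) = 0
      simp [hmulcol _ _ (hcol0 X), hcol0 X]
    · simp [hmulcol _ _ (hcol0 X), hcol0 X, coordMat_apply, hcol]
  rw [dNormMat_offCol fun s => by rw [Matrix.sub_apply, hcol1 X Y s, hcol1 Y X s, sub_zero],
    normMat_coordP_one, one_mul, mul_one, hα, maurerCartan, theta_one, lie_heisVec]
  have hαv : (α (heisVec (lowerCol (G * Y.1) + ![0, 0, lowerCol X.1 1 * lowerCol Y.1 0] -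
      (lowerCol (G' * X.1) + ![0, 0, lowerCol Y.1 1 * lowerCol X.1 0])))).1 =
      coordMat α (lowerCol (G * Y.1)) - coordMat α (lowerCol (G' * X.1)) +
        coordMat α ![0, 0, lowerCol X.1 1 * lowerCol Y.1 0 - lowerCol Y.1 1 * lowerCol X.1 0] := by
    rw [← coordMat_apply, ← map_sub, ← map_add]
    congr 1
    funext i
    simp only [Pi.add_apply, Pi.sub_apply]
    generalize lowerCol (G * Y.1) i = p
    generalize lowerCol (G' * X.1) i = q
    fin_cases i <;> simp; ring
  have hlhs : (⁅X, Y⁆ - (⁅α (heisVec (lowerCol X.1)), α (heisVec (lowerCol Y.1))⁆ -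
      α (heisVec ![0, 0, lowerCol X.1 1 * lowerCol Y.1 0 - lowerCol Y.1 1 * lowerCol X.1 0]))).1 =
      X.1 * Y.1 - Y.1 * X.1 - (coordMat α (lowerCol X.1) * coordMat α (lowerCol Y.1) -
        coordMat α (lowerCol Y.1) * coordMat α (lowerCol X.1) -
        coordMat α ![0, 0, lowerCol X.1 1 * lowerCol Y.1 0 - lowerCol Y.1 1 * lowerCol X.1 0]) :=
    rfl
  -- what remains is an identity between noncommutative polynomials in `X`, `Y`, `α(x)`, `α(y)`;
  -- the other values of `α` and all scalars may be arbitrary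
  refine hlhs.trans ?_
  rw [hαv]
  generalize coordMat α ![0, 0, lowerCol X.1 1 * lowerCol Y.1 0 -
    lowerCol Y.1 1 * lowerCol X.1 0] = B
  generalize topEntry (coordMat α (lowerCol (G * Y.1))) - topEntry (G * Y.1) = s₁
  generalize topEntry (coordMat α (lowerCol (G' * X.1))) - topEntry (G' * X.1) = s₂
  generalize coordMat α (lowerCol (G * Y.1)) = D₁
  generalize coordMat α (lowerCol (G' * X.1)) = D₂
  have hG1 : G = X.1 - coordMat α (lowerCol X.1) +
      (topEntry (coordMat α (lowerCol X.1)) - topEntry X.1) • 1 := by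
    rw [hG, fieldMat, one_mul, mul_one]
  have hG1' : G' = Y.1 - coordMat α (lowerCol Y.1) +
      (topEntry (coordMat α (lowerCol Y.1)) - topEntry Y.1) • 1 := by
    rw [hG', fieldMat, one_mul, mul_one]
  rw [hG1, hG1']
  generalize topEntry (coordMat α (lowerCol X.1)) - topEntry X.1 = r₁
  generalize topEntry (coordMat α (lowerCol Y.1)) - topEntry Y.1 = r₂
  simp only [add_mul, mul_add, sub_mul, mul_sub, smul_mul_assoc, mul_smul_comm, one_mul, mul_one]
  module

/-- The curvature function of `ω` at the base point is the curvature of the extension `α`. -/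
lemma isExtensionCurvature_curvature {ω : CartanConnection} {α : heisAlg →ₗ[ℝ] sl4}
    (hcol : ∀ x i, (α (heisVec x)).1 (Sum.inr i) (Sum.inl ()) = x i)
    (hα : ∀ y v, ω.pullback y v = α (maurerCartan y v)) :
    IsExtensionCurvature α (ω.curvature (1, 1)) := by
  have hlow : ∀ (x : heisAlg), ∀ U ∈ parab, heisVec (lowerCol (α x + U).1) = x := by
    intro x U hU
    have h : lowerCol (α x + U).1 = heisCoord x := by
      funext i
      have h1 := hcol (heisCoord x) i
      rw [heisVec_heisCoord] at h1
      rw [lowerCol_apply, ← h1]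
      change (α x).1 _ _ + U.1 _ _ = _
      rw [hU i, add_zero]
    rw [h, heisVec_heisCoord]
  intro x y U hU V hV
  rw [curvature_eq hcol hα, hlow x U hU, hlow y V hV]

/-! ### The extension defined by an invariant Cartan connection -/

/-- The trivial subgroup has trivial Lie algebra: differentiate `exp(tx) = 1`. -/
lemma isotropyAlg_bot (x : heisAlg) : x ∈ isotropyAlg ⊥ ↔ x = 0 := by
  constructor
  · intro h
    have hexp : ∀ t : ℝ, NormedSpace.exp (t • x.1) = 1 := by
      intro t
      obtain ⟨k, h1⟩ := h t
      obtain rfl : k = 1 := Subsingleton.elim _ _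
      exact (congrArg Units.val h1).symm
    have h1 := hasDerivAt_exp_smul_const (𝕂 := ℝ) x.1 0
    rw [zero_smul, NormedSpace.exp_zero, one_mul] at h1
    have h2 : HasDerivAt (fun t : ℝ => NormedSpace.exp (t • x.1)) 0 0 := by
      simp only [hexp]
      exact hasDerivAt_const _ _
    exact Subtype.ext (h1.unique h2)
  · rintro rfl t
    refine ⟨1, Units.ext ?_⟩
    change (1 : Matrix (Fin 3) (Fin 3) ℝ) = NormedSpace.exp (t • (0 : Matrix (Fin 3) (Fin 3) ℝ))
    rw [smul_zero, NormedSpace.exp_zero]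

/-- For trivial isotropy, an extension is just a linear map inducing `𝔨 ≅ 𝔤/𝔭₁`. -/
lemma isExtension_bot {α : heisAlg →ₗ[ℝ] sl4}
    (hcol : ∀ x i, (α (heisVec x)).1 (Sum.inr i) (Sum.inl ()) = x i) :
    IsExtension ⊥ 1 α where
  continuous := continuous_const
  injective := Function.injective_of_subsingleton _
  equivariant h x := by
    obtain rfl : h = 1 := Subsingleton.elim _ _
    have hx : adH ((1 : (⊥ : Subgroup H12)) : H12) x = x := by
      apply Subtype.ext
      simp [adH]
    rw [hx, MonoidHom.one_apply, OneMemClass.coe_one, map_one, Module.End.one_apply]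
  differential x hx t h _ := by
    rw [(isotropyAlg_bot x).1 hx, map_zero]
    have h1 : expGL (t • ((0 : sl4) : Matrix Idx Idx ℝ)) = 1 := by
      apply Units.ext
      change NormedSpace.exp (t • (0 : Matrix Idx Idx ℝ)) = 1
      rw [smul_zero, NormedSpace.exp_zero]
    rw [h1, MonoidHom.one_apply, OneMemClass.coe_one]
    exact (map_one Matrix.ProjGenLinGroup.mk).symm
  mem_parab_iff x := by
    rw [isotropyAlg_bot]
    constructor
    · intro h
      have h1 : heisCoord x = 0 := by
        funext i
        rw [← hcol (heisCoord x) i, heisVec_heisCoord]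
        exact h i
      rw [← heisVec_heisCoord x, h1]
      exact map_zero heisVecLin
    · rintro rfl
      rw [map_zero]
      exact parab.zero_mem
  surjective X := by
    refine ⟨heisVec (lowerCol X.1), fun i => ?_⟩
    change X.1 _ _ - (α _).1 _ _ = 0
    rw [hcol, lowerCol_apply, sub_self]

/-- The linear map `𝔨 → 𝔤` given by the value of `τ^*ω` at the identity of `H₁₂`. -/
def extensionAtOne (ω : CartanConnection) : heisAlg →ₗ[ℝ] sl4 :=
  ω.form (1, 1) ∘ₗ LinearMap.inl ℝ _ _ ∘ₗ heisCoordLin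

lemma extensionAtOne_heisVec (ω : CartanConnection) (x : Fin 3 → ℝ) :
    extensionAtOne ω (heisVec x) = ω.pullback 1 x := by
  rw [pullback_eq]
  change ω.form (1, 1) (heisCoord (heisVec x), 0) = _
  rw [heisCoord_heisVec]

end HeisProj

theorem mainTheorem6 (ω : HeisProj.CartanConnection)
    (a : Fin 3 → HeisProj.H12 → ℝ)
    (A : Fin 3 → Fin 3 → Fin 3 → HeisProj.H12 → ℝ)
    (Rho : Fin 3 → Fin 3 → HeisProj.H12 → ℝ)
    (hω : ∀ (y : HeisProj.H12) (v : Fin 3 → ℝ),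
      (ω.pullback y v : Matrix HeisProj.Idx HeisProj.Idx ℝ) =
        HeisProj.adaptedMatrix (fun k => a k y) (fun j k i => A j k i y)
          (fun k j => Rho k j y) (HeisProj.theta y v)) :
    (ω.IsInvariant ↔
      (∀ k, ∃ c, ∀ y, a k y = c) ∧ (∀ j k i, ∃ c, ∀ y, A j k i y = c) ∧
        (∀ k j, ∃ c, ∀ y, Rho k j y = c)) ∧
    (∀ (a₀ : Fin 3 → ℝ) (A₀ : Fin 3 → Fin 3 → Fin 3 → ℝ) (Rho₀ : Fin 3 → Fin 3 → ℝ),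
      (∀ k y, a k y = a₀ k) → (∀ j k i y, A j k i y = A₀ j k i) →
      (∀ k j y, Rho k j y = Rho₀ k j) →
      ∃ α : HeisProj.heisAlg →ₗ[ℝ] HeisProj.sl4,
        (∀ x : Fin 3 → ℝ, (α (HeisProj.heisVec x) : Matrix HeisProj.Idx HeisProj.Idx ℝ) =
          HeisProj.adaptedMatrix a₀ A₀ Rho₀ x) ∧
        HeisProj.IsExtension ⊥ 1 α ∧
        (∀ (y : HeisProj.H12) (v : Fin 3 → ℝ),
          ω.pullback y v = α (HeisProj.maurerCartan y v)) ∧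
        (ω.IsNormal → HeisProj.IsNormalExtension ⊥ 1 α)) := by
  refine ⟨HeisProj.isInvariant_iff_const ω a A Rho hω, fun a₀ A₀ Rho₀ ha hA hRho => ?_⟩
  simp only [ha, hA, hRho] at hω
  have hmat : ∀ x, (HeisProj.extensionAtOne ω (HeisProj.heisVec x)).1 =
      HeisProj.adaptedMatrix a₀ A₀ Rho₀ x := by
    intro x
    rw [HeisProj.extensionAtOne_heisVec, hω, HeisProj.theta_one]
  have hcol : ∀ x i, (HeisProj.extensionAtOne ω (HeisProj.heisVec x)).1
      (Sum.inr i) (Sum.inl ()) = x i := by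
    intro x i
    rw [hmat]
    rfl
  have hα : ∀ y v, ω.pullback y v = HeisProj.extensionAtOne ω (HeisProj.maurerCartan y v) := by
    intro y v
    apply Subtype.ext
    rw [hω, HeisProj.maurerCartan, hmat]
  have hext := HeisProj.isExtension_bot hcol
  exact ⟨HeisProj.extensionAtOne ω, hmat, hext, hα, fun hn =>
    ⟨hext, _, HeisProj.isExtensionCurvature_curvature hcol hα, hn (1, 1)⟩⟩
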